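/- Let $\mathcal N$ be an inhomogeneous Poisson point process on $(0,\infty)$ with intensity measure $\mu(t)\,\mathrm dt$, where the rate function $\mu\ge 0$ satisfies $\int_0^t\mu(s)\,\mathrm ds<\infty$ for every $t>0$ and $\mu(t)>0$ for Lebesgue-almost every $t>0$. Let $0<T_1<T_2<\cdots$ be its epochs, put $T_0=0$ (and $T_{n+1}=\infty$ if $T_n$ is the last epoch), fix $\ell>0$, and let $$D=\min\{T_n:\ n\ge 0,\ T_n<\infty,\ T_{n+1}-T_n\ge \ell\}$$ be the first epoch that is followed by a gap of length at least $\ell$ (with $D=\infty$ if there is none). Assume that $\mu$ is eventually non-increasing. Let $\alpha\ge 1$ and let $f$ be regularly varying at $\infty$ with index $\alpha$, that is, $f$ is positive and measurable on some half-line $[X,\infty)$ and $f(\lambda t)/f(t)\to\lambda^{\alpha}$ as $t\to\infty$ for every $\lambda>0$. Assume that $t/f(t)\to 0$ as $t\to\infty$, and that there is $\rho\in\mathbb R$ such that for every $c>0$ $$\sum_{i=1}^n\log\mu(ic)\ \sim\ -c^{\rho}f(n)\qquad\text{as } n\to\infty,$$ where $a_n\sim b_n$ means $a_n/b_n\to 1$.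 Then, as $t\to\infty$, $$\mathbb P(D>t)\ \approx_{\log}\ \exp\bigl(-\ell^{\rho-\alpha}f(t)\bigr),\qquad\text{i.e.}\qquad \frac{\log \mathbb P(D>t)}{-\ell^{\rho-\alpha}f(t)}\ \to\ 1 .$$ -/

import Mathlib

open MeasureTheory ProbabilityTheory Filter Topology Set

noncomputable section

namespace FirstGap

/-- The measure `M(dt) = μ(t) dt` on `(0, ∞)`, as a measure on `ℝ` that vanishes on `(-∞, 0]`. -/
def intensityMeasure (μ : ℝ → ℝ) : Measure ℝ :=
  (volume.restrict (Ioi (0 : ℝ))).withDensity (fun t => ENNReal.ofReal (μ t))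

/-- The number of points of the set `S` that lie in `B`. -/
def count (S B : Set ℝ) : ℕ∞ := (S ∩ B).encard

/-- `N` is a Poisson point process on `(0, ∞)`, represented as a random subset of `(0, ∞)`, with
intensity measure `M`: the number of points in a Borel set of finite intensity `m` has the
Poisson distribution of mean `m`, and the numbers of points in disjoint Borel sets are
independent. (In particular a Borel set of finite intensity almost surely contains only finitely
many points.) -/
structure IsPoissonProcess {Ω : Type*} [MeasurableSpace Ω] (N : Ω → Set ℝ) (M : Measure ℝ)
    (P : Measure Ω) : Prop where
  subset_Ioi : ∀ ω, N ω ⊆ Ioi 0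
  measurable_count : ∀ B : Set ℝ, MeasurableSet B → Measurable (fun ω => count (N ω) B)
  map_count : ∀ B : Set ℝ, MeasurableSet B → M B < ⊤ →
    P.map (fun ω => count (N ω) B)
      = (poissonMeasure (M B).toNNReal).map (fun k : ℕ => (k : ℕ∞))
  indep_count : ∀ (n : ℕ) (B : Fin n → Set ℝ), (∀ i, MeasurableSet (B i)) →
    Pairwise (fun i j => Disjoint (B i) (B j)) →
    iIndepFun (fun (i : Fin n) (ω : Ω) => count (N ω) (B i)) P

/-- The epochs of the point set `S`: `T₀ = 0`, and `T_{n+1}` is the first point of `S` after `Tₙ`,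
with `T_{n+1} = ∞` if there is none. -/
def epoch (S : Set ℝ) : ℕ → EReal
  | 0 => 0
  | n + 1 => sInf {x : EReal | (∃ s ∈ S, (s : EReal) = x) ∧ epoch S n < x}

/-- `D = min {Tₙ : T_{n+1} - Tₙ ≥ ℓ}`, the first epoch that is followed by a gap of size at least
`ℓ`; it is `∞` if there is no such epoch. -/
def firstGap (ℓ : ℝ) (S : Set ℝ) : EReal :=
  sInf {x : EReal | ∃ n : ℕ, x = epoch S n ∧ epoch S n < ⊤ ∧
    (ℓ : EReal) ≤ epoch S (n + 1) - epoch S n}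

/-- `f` is regularly varying at infinity with index `α`: it is positive and measurable on some
half-line `[X, ∞)`, and `f (lam * t) / f t → lam ^ α` as `t → ∞`, for every `lam > 0`. -/
def IsRegularlyVarying (f : ℝ → ℝ) (α : ℝ) : Prop :=
  (∃ X : ℝ, (∀ t ∈ Ici X, 0 < f t) ∧ Measurable (fun t : Ici X => f t)) ∧
    ∀ lam : ℝ, 0 < lam → Tendsto (fun t => f (lam * t) / f t) atTop (𝓝 (lam ^ α))

/-- Asymptotic equivalence `u ∼ v` of sequences: `u n / v n → 1`. -/
def SeqEquiv (u v : ℕ → ℝ) : Prop :=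
  Tendsto (fun n => u n / v n) atTop (𝓝 1)

/-- Logarithmic asymptotics as `t → ∞`: `log (u t) / log (v t) → 1`. -/
def LogEquiv (u v : ℝ → ℝ) : Prop :=
  Tendsto (fun t => Real.log (u t) / Real.log (v t)) atTop (𝓝 1)

end FirstGap

end

/-! `D > t` is squeezed between two events that ask for a point in each of many disjoint intervals,
whose probability is a product of factors `1 - exp (-m)`. If no gap of length `ℓ` starts up to `t`,
each block of length `ℓ` starting by `t` holds a point (`exists_log_firstGap_le`). Conversely, for
`c < ℓ`, points in short windows at the ends of the blocks of length `c` rule out such gaps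
(`exists_le_log_firstGap`). As `μ` is eventually monotone, each log-factor is bounded by `log (μ (i
* c))` up to an additive constant. These constants sum to `O(t) = o(f t)`, so `hsum` and uniform
convergence for `f` give the exponent `c ^ (ρ - α) * f t` (`tendsto_sum_log_div`). Letting `c`
increase to `ℓ` closes the squeeze. -/

namespace FirstGap

/-! ### Uniform convergence for regularly varying functions -/

/-- Uniform convergence for slowly varying functions, in additive form along sequences. -/
theorem tendsto_sub_of_bounded_shift {g : ℝ → ℝ} (hg : Measurable g)
    (h : ∀ u, Tendsto (fun x => g (x + u) - g x) atTop (𝓝 0)) {x u : ℕ → ℝ}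
    (hx : Tendsto x atTop atTop) {R : ℝ} (hu : ∀ n, |u n| ≤ R) :
    Tendsto (fun n => g (x n + u n) - g (x n)) atTop (𝓝 0) := by
  -- Wide enough to contain both `v` and `v - u n` for every `v ∈ [0, 2]`.
  set J : Set ℝ := Icc (-(R + 2)) (R + 2)
  have key : ∀ y : ℕ → ℝ, Tendsto y atTop atTop → ∀ ε > 0, ∀ᶠ n in atTop,
      volume ({v | ε ≤ |g (y n + v) - g (y n)|} ∩ J) < 1 := by
    intro y hy ε hε
    have hm : TendstoInMeasure (volume.restrict J) (fun n v => g (y n + v) - g (y n)) atTop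
        (fun _ => (0 : ℝ)) :=
      tendstoInMeasure_of_tendsto_ae
        (fun n => ((hg.comp (measurable_const_add _)).sub_const _).aestronglyMeasurable)
        (Eventually.of_forall fun v => (h v).comp hy)
    rw [tendstoInMeasure_iff_norm] at hm
    have h1 := (hm ε hε).eventually (gt_mem_nhds (zero_lt_one' ENNReal))
    filter_upwards [h1] with n hn
    rw [Measure.restrict_apply' measurableSet_Icc] at hn
    simpa only [sub_zero, Real.norm_eq_abs] using hn
  have hy : Tendsto (fun n => x n + u n) atTop atTop :=
    tendsto_atTop_add_right_of_le _ (-R) hx fun n => (abs_le.1 (hu n)).1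
  rw [Metric.tendsto_nhds]
  intro ε hε
  filter_upwards [key x hx (ε / 2) (by positivity), key _ hy (ε / 2) (by positivity)] with n h1 h2
  set A := {v | ε / 2 ≤ |g (x n + v) - g (x n)|} ∩ J
  set B := {v | ε / 2 ≤ |g (x n + u n + v) - g (x n + u n)|} ∩ J
  have hB : volume ((fun v => v + -u n) ⁻¹' B) = volume B := measure_preimage_add_right _ _ _
  -- The two bad sets have measure below `1` each, so they cannot cover `[0, 2]`. A good `v` makes
  -- `g (x n)` and `g (x n + u n)` both close to `g (x n + v)`.
  have hex : ∃ v ∈ Icc (0 : ℝ) 2, v ∉ A ∧ v + -u n ∉ B := by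
    by_contra! hcon
    have hsub : Icc (0 : ℝ) 2 ⊆ A ∪ (fun v => v + -u n) ⁻¹' B := fun v hv => by
      by_cases hvA : v ∈ A
      · exact Or.inl hvA
      · exact Or.inr (hcon v hv hvA)
    have h3 := (measure_mono hsub).trans (measure_union_le (μ := volume) _ _)
    rw [hB, Real.volume_Icc] at h3
    have h4 := h3.trans_lt (ENNReal.add_lt_add h1 h2)
    norm_num at h4
  obtain ⟨v, hv, hvA, hvB⟩ := hex
  have hun := abs_le.1 (hu n)
  have hR : 0 ≤ R := (abs_nonneg _).trans (hu n)
  have h3 : |g (x n + v) - g (x n)| < ε / 2 := by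
    by_contra! hc
    exact hvA ⟨hc, by constructor <;> linarith [hv.1, hv.2]⟩
  have h4 : |g (x n + u n + (v + -u n)) - g (x n + u n)| < ε / 2 := by
    by_contra! hc
    exact hvB ⟨hc, by constructor <;> linarith [hv.1, hv.2]⟩
  rw [show x n + u n + (v + -u n) = x n + v by ring] at h4
  rw [Real.dist_eq, sub_zero]
  rw [abs_lt] at *
  constructor <;> linarith [h3.1, h3.2, h4.1, h4.2]

theorem IsRegularlyVarying.eventually_pos {f : ℝ → ℝ} {α : ℝ} (hf : IsRegularlyVarying f α) :
    ∀ᶠ t in atTop, 0 < f t := by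
  obtain ⟨⟨X, hX, -⟩, -⟩ := hf
  exact (eventually_ge_atTop X).mono hX

/-- A function that is regularly varying agrees eventually with a measurable function. -/
theorem IsRegularlyVarying.exists_measurable {f : ℝ → ℝ} {α : ℝ} (hf : IsRegularlyVarying f α) :
    ∃ F : ℝ → ℝ, Measurable F ∧ F =ᶠ[atTop] f := by
  obtain ⟨⟨X, -, hX⟩, -⟩ := hf
  refine ⟨fun t => f (max t X), ?_, ?_⟩
  · exact hX.comp (f := fun t : ℝ => (⟨max t X, mem_Ici.2 (le_max_right _ _)⟩ : Ici X))
      (Measurable.subtype_mk (by fun_prop))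
  · filter_upwards [eventually_ge_atTop X] with t ht
    rw [max_eq_left ht]

/-- The uniform convergence theorem for regularly varying functions. -/
theorem IsRegularlyVarying.tendsto_div {f : ℝ → ℝ} {α : ℝ} (hf : IsRegularlyVarying f α)
    {y : ℝ → ℝ} {lam : ℝ} (hlam : 0 < lam) (hy : Tendsto (fun t => y t / t) atTop (𝓝 lam)) :
    Tendsto (fun t => f (y t) / f t) atTop (𝓝 (lam ^ α)) := by
  obtain ⟨F, hFm, hF⟩ := hf.exists_measurable
  have hFpos : ∀ᶠ t in atTop, 0 < F t := by
    filter_upwards [hF, hf.eventually_pos] with t h1 h2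
    rwa [h1]
  -- Logarithmic coordinates, with the power `t ^ α` divided out: what remains is slowly varying in
  -- additive form.
  set g : ℝ → ℝ := fun x => Real.log (F (Real.exp x)) - α * x with hgdef
  have hg : Measurable g := by
    have : Measurable fun x => F (Real.exp x) := hFm.comp Real.measurable_exp
    fun_prop
  have hshift : ∀ u, Tendsto (fun x => g (x + u) - g x) atTop (𝓝 0) := by
    intro u
    have h1 := (hf.2 (Real.exp u) (Real.exp_pos u)).comp Real.tendsto_exp_atTop
    have h2 := (h1.log (by positivity)).sub_const (α * u)
    rw [Real.log_rpow (Real.exp_pos u), Real.log_exp, sub_self] at h2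
    refine h2.congr' ?_
    have h3 : Tendsto (fun x => Real.exp u * Real.exp x) atTop atTop :=
      Real.tendsto_exp_atTop.const_mul_atTop (Real.exp_pos u)
    filter_upwards [Real.tendsto_exp_atTop.eventually hF, Real.tendsto_exp_atTop.eventually hFpos,
      h3.eventually hF, h3.eventually hFpos] with x e1 p1 e2 p2
    simp only [Function.comp, hgdef]
    rw [← e1, ← e2, Real.log_div p2.ne' p1.ne', add_comm x u, Real.exp_add]
    ring
  have hylog : Tendsto (fun t => Real.log (y t / t)) atTop (𝓝 (Real.log lam)) :=
    hy.log hlam.ne'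
  have hypos : ∀ᶠ t in atTop, 0 < y t / t := hy.eventually (lt_mem_nhds hlam)
  have hytop : Tendsto y atTop atTop := by
    refine (hy.pos_mul_atTop hlam tendsto_id).congr' ?_
    filter_upwards [eventually_gt_atTop 0] with t ht
    simp only [id]
    field_simp
  have hmain : Tendsto (fun t => g (Real.log t + Real.log (y t / t)) - g (Real.log t)) atTop
      (𝓝 0) := by
    set R := |Real.log lam| + 1
    -- Truncation makes the shift bounded for every `t` and changes nothing for large `t`.
    set u : ℝ → ℝ := fun t => max (-R) (min R (Real.log (y t / t)))
    have hR : 0 ≤ R := by positivity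
    have hue : ∀ᶠ t in atTop, Real.log (y t / t) = u t := by
      have := hylog.abs.eventually (gt_mem_nhds (lt_add_one |Real.log lam|))
      filter_upwards [this] with t ht
      have := abs_lt.1 ht
      simp only [u]
      rw [min_eq_right this.2.le, max_eq_right this.1.le]
    have : Tendsto (fun t => g (Real.log t + u t) - g (Real.log t)) atTop (𝓝 0) := by
      refine tendsto_of_seq_tendsto fun s hs => ?_
      refine tendsto_sub_of_bounded_shift (x := fun n => Real.log (s n)) (u := fun n => u (s n))
        (R := R) hg hshift (Real.tendsto_log_atTop.comp hs) fun n => ?_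
      rw [abs_le]
      exact ⟨le_max_left _ _, max_le (by linarith) (min_le_left _ _)⟩
    refine this.congr' ?_
    filter_upwards [hue] with t ht
    rw [ht]
  have hexp := (Real.continuous_exp.tendsto _).comp (hmain.add (hylog.const_mul α))
  rw [zero_add, mul_comm, ← Real.rpow_def_of_pos hlam] at hexp
  refine hexp.congr' ?_
  filter_upwards [eventually_gt_atTop 0, hypos, hF, hFpos, hytop.eventually hF,
    hytop.eventually hFpos, hytop.eventually_gt_atTop 0] with t ht hyt e1 p1 e2 p2 hy0
  simp only [Function.comp, hgdef]
  rw [← Real.log_mul ht.ne' hyt.ne', mul_div_cancel₀ _ ht.ne', Real.exp_log hy0, Real.exp_log ht,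
    ← e1, ← e2, Real.log_div hy0.ne' ht.ne']
  rw [show Real.log (F (y t)) - α * Real.log (y t) - (Real.log (F t) - α * Real.log t) +
    α * (Real.log (y t) - Real.log t) = Real.log (F (y t)) - Real.log (F t) by ring,
    Real.exp_sub, Real.exp_log p1, Real.exp_log p2]


theorem count_ne_zero_iff {S B : Set ℝ} : count S B ≠ 0 ↔ (S ∩ B).Nonempty := by
  simp [count, nonempty_iff_ne_empty]

/-! ### Occupation probabilities of the Poisson process -/

section Poisson

variable {Ω : Type*} [MeasurableSpace Ω] {P : Measure Ω} {N : Ω → Set ℝ} {M : Measure ℝ}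

theorem IsPoissonProcess.measure_count_preimage (hN : IsPoissonProcess N M P) {B : Set ℝ}
    (hB : MeasurableSet B) (hM : M B < ⊤) (A : Set ℕ∞) :
    P ((fun ω => count (N ω) B) ⁻¹' A)
      = poissonMeasure (M B).toNNReal ((fun k : ℕ => (k : ℕ∞)) ⁻¹' A) := by
  have hA : MeasurableSet A := .of_discrete
  rw [← Measure.map_apply (hN.measurable_count B hB) hA, hN.map_count B hB hM,
    Measure.map_apply (measurable_of_countable _) hA]

theorem IsPoissonProcess.ae_finite_inter (hN : IsPoissonProcess N M P) {B : Set ℝ}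
    (hB : MeasurableSet B) (hM : M B < ⊤) : ∀ᵐ ω ∂P, (N ω ∩ B).Finite := by
  have h := hN.measure_count_preimage hB hM {⊤}
  have h0 : (fun k : ℕ => (k : ℕ∞)) ⁻¹' {⊤} = ∅ := by ext k; simp
  rw [h0, measure_empty] at h
  refine measure_mono_null (fun ω hω => ?_) h
  rw [mem_preimage, mem_singleton_iff, count, encard_eq_top_iff]
  exact hω

theorem IsPoissonProcess.measureReal_inter_nonempty [IsProbabilityMeasure P]
    (hN : IsPoissonProcess N M P) {B : Set ℝ} (hB : MeasurableSet B) (hM : M B < ⊤) :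
    P.real {ω | (N ω ∩ B).Nonempty} = 1 - Real.exp (-(M B).toReal) := by
  have hset : {ω | (N ω ∩ B).Nonempty} = ((fun ω => count (N ω) B) ⁻¹' {0})ᶜ := by
    ext ω
    exact count_ne_zero_iff.symm
  have h0 : (fun k : ℕ => (k : ℕ∞)) ⁻¹' {0} = {0} := by ext k; simp
  rw [hset, probReal_compl_eq_one_sub (hN.measurable_count B hB .of_discrete),
    measureReal_def, hN.measure_count_preimage hB hM, h0, ← measureReal_def,
    poissonMeasure_real_singleton]
  simp [ENNReal.coe_toNNReal_eq_toReal]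

theorem IsPoissonProcess.measureReal_forall_inter_nonempty [IsProbabilityMeasure P]
    (hN : IsPoissonProcess N M P) {n : ℕ} {B : ℕ → Set ℝ} (hB : ∀ i, MeasurableSet (B i))
    (hd : Pairwise (fun i j => Disjoint (B i) (B j))) (hM : ∀ i, M (B i) < ⊤) :
    P.real {ω | ∀ i < n, (N ω ∩ B i).Nonempty}
      = ∏ i ∈ Finset.range n, (1 - Real.exp (-(M (B i)).toReal)) := by
  have h := (hN.indep_count n (fun i => B i) (fun i => hB i)
    (fun i j hij => hd (fun h => hij (Fin.ext h)))).measure_inter_preimage_eq_mul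
    (sets := fun _ => {0}ᶜ) Finset.univ (fun _ _ => .of_discrete)
  have hset : {ω | ∀ i < n, (N ω ∩ B i).Nonempty}
      = ⋂ i ∈ (Finset.univ : Finset (Fin n)), (fun ω => count (N ω) (B i)) ⁻¹' {0}ᶜ := by
    ext ω
    simp only [mem_ofPred_eq, Finset.mem_univ, iInter_true, mem_iInter, mem_preimage,
      mem_compl_iff, mem_singleton_iff]
    simp only [← ne_eq, count_ne_zero_iff]
    exact ⟨fun h i => h i i.2, fun h i hi => h ⟨i, hi⟩⟩
  rw [measureReal_def, hset, h, ENNReal.toReal_prod, Finset.prod_range]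
  refine Finset.prod_congr rfl fun i _ => ?_
  rw [← hN.measureReal_inter_nonempty (hB i) (hM i), measureReal_def]
  congr 2
  ext ω
  exact count_ne_zero_iff

end Poisson

/-! ### Deterministic comparison of gaps and occupied intervals -/

section Epochs

variable {S : Set ℝ} {ℓ : ℝ}

theorem epoch_succ_le {n : ℕ} {s : ℝ} (hs : s ∈ S) (h : epoch S n < s) : epoch S (n + 1) ≤ s :=
  sInf_le ⟨⟨s, hs, rfl⟩, h⟩

theorem epoch_le_succ (S : Set ℝ) (n : ℕ) : epoch S n ≤ epoch S (n + 1) :=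
  le_sInf fun _ hx => hx.2.le

theorem epoch_nonneg (S : Set ℝ) (n : ℕ) : 0 ≤ epoch S n :=
  monotone_nat_of_le_succ (epoch_le_succ S) (Nat.zero_le n)

/-- A point set that is finite on bounded intervals attains its epochs. -/
theorem exists_epoch_succ_eq {b : ℝ} (hpos : S ⊆ Ioi 0) (hfin : (S ∩ Ioc 0 b).Finite) {n : ℕ}
    (h : epoch S (n + 1) < b) : ∃ s ∈ S, (s : EReal) = epoch S (n + 1) ∧ epoch S n < s := by
  set A : Set EReal := {x | (∃ s ∈ S, (s : EReal) = x) ∧ epoch S n < x} with hA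
  have hAdef : epoch S (n + 1) = sInf A := rfl
  -- Cutting at `b` leaves a finite set with the same infimum, which is therefore attained.
  set A' : Set EReal := A ∩ Iio b
  have hA'fin : A'.Finite := by
    refine (hfin.image (fun s : ℝ => (s : EReal))).subset ?_
    rintro _ ⟨⟨⟨s, hs, rfl⟩, -⟩, hb⟩
    exact ⟨s, ⟨hs, hpos hs, EReal.coe_le_coe_iff.1 (le_of_lt hb)⟩, rfl⟩
  have hne : A'.Nonempty := by
    rw [hAdef] at h
    obtain ⟨a, ha, hab⟩ := sInf_lt_iff.1 h
    exact ⟨a, ha, hab⟩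
  have hmem := hne.csInf_mem hA'fin
  have heq : sInf A' = sInf A := by
    refine le_antisymm (le_sInf fun a ha => ?_) (sInf_le_sInf inter_subset_left)
    rcases lt_or_ge a (b : EReal) with hab | hab
    · exact sInf_le ⟨ha, hab⟩
    · exact (le_of_lt hmem.2).trans hab
  rw [heq] at hmem
  obtain ⟨⟨⟨s, hs, hsx⟩, hlt⟩, -⟩ := hmem
  exact ⟨s, hs, hsx.trans hAdef.symm, by rw [hsx]; exact hlt⟩

/-- Otherwise the epochs would be infinitely many distinct points of `S` in `(0, a + 1]`. -/
theorem exists_lt_epoch {a : ℝ} (hpos : S ⊆ Ioi 0) (hfin : (S ∩ Ioc 0 (a + 1)).Finite) :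
    ∃ n, (a : EReal) < epoch S n := by
  by_contra! hcon
  have hlt : ∀ n, epoch S (n + 1) < ((a + 1 : ℝ) : EReal) := fun n =>
    (hcon _).trans_lt (EReal.coe_lt_coe_iff.2 (lt_add_one a))
  choose s hs hse hsl using fun n => exists_epoch_succ_eq (n := n) hpos hfin (hlt n)
  have hmono : StrictMono s := strictMono_nat_of_lt_succ fun n => by
    have := hsl (n + 1)
    rw [← hse n] at this
    exact EReal.coe_lt_coe_iff.1 this
  refine infinite_range_of_injective hmono.injective (hfin.subset ?_)
  rintro _ ⟨n, rfl⟩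
  refine ⟨hs n, hpos (hs n), EReal.coe_le_coe_iff.1 ?_⟩
  rw [hse n]
  exact (hlt n).le

/-- As long as no gap of length `ℓ` has started, every interval of length `ℓ` contains a point. -/
theorem inter_nonempty_of_lt_firstGap {t a : ℝ} (hpos : S ⊆ Ioi 0)
    (hfin : (S ∩ Ioc 0 (a + 1)).Finite) (ha : 0 ≤ a) (hat : a ≤ t)
    (h : (t : EReal) < firstGap ℓ S) : (S ∩ Ioc a (a + ℓ)).Nonempty := by
  classical
  have hex := exists_lt_epoch hpos hfin
  obtain ⟨m, hm⟩ : ∃ m, Nat.find hex = m + 1 := by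
    refine Nat.exists_eq_succ_of_ne_zero fun h0 => ?_
    have := Nat.find_spec hex
    rw [h0] at this
    exact absurd this (not_lt.2 (EReal.coe_nonneg.2 ha : epoch S 0 ≤ a))
  have hgt : (a : EReal) < epoch S (m + 1) := hm ▸ Nat.find_spec hex
  have hle : epoch S m ≤ a := not_lt.1 (Nat.find_min hex (by omega))
  -- `T_m ≤ a < T_{m+1}`, and `T_m` cannot start a long gap because `T_m ≤ t < D`.
  have hlt : epoch S (m + 1) - epoch S m < ℓ := by
    by_contra! hc
    have : firstGap ℓ S ≤ epoch S m :=
      sInf_le ⟨m, rfl, hle.trans_lt (EReal.coe_lt_top a), hc⟩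
    exact absurd h (not_lt.2 (this.trans (hle.trans (EReal.coe_le_coe_iff.2 hat))))
  obtain ⟨e, he⟩ : ∃ e : ℝ, epoch S m = e := by
    refine ⟨(epoch S m).toReal, (EReal.coe_toReal ?_ ?_).symm⟩
    · exact (hle.trans_lt (EReal.coe_lt_top a)).ne
    · exact ((EReal.bot_lt_coe 0).trans_le (epoch_nonneg S m)).ne'
  have hlt' : epoch S (m + 1) < ((a + ℓ : ℝ) : EReal) := by
    rw [he] at hlt hle
    rw [EReal.sub_lt_iff (by simp) (by simp)] at hlt
    refine hlt.trans_le ?_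
    rw [EReal.coe_add, add_comm]
    gcongr
  obtain ⟨_, ⟨⟨s, hs, rfl⟩, hms⟩, hsl⟩ := sInf_lt_iff.1 hlt'
  exact ⟨s, hs, EReal.coe_lt_coe_iff.1 (hgt.trans_le (epoch_succ_le hs hms)),
    EReal.coe_le_coe_iff.1 hsl.le⟩

/-- If each of the short intervals at the end of consecutive intervals of length `c` contains
a point, then no gap of length `ℓ` starts before the last of these intervals. -/
theorem lt_firstGap_of_forall_inter_nonempty {t c w : ℝ} {n : ℕ} (hw : 0 < w) (hwc : w < c)
    (hcw : c + w < ℓ) (hn : t + 2 * c ≤ n * c)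
    (h : ∀ i < n, (S ∩ Ioc ((i + 1) * c - w) ((i + 1) * c)).Nonempty) :
    (t : EReal) < firstGap ℓ S := by
  have hc : 0 < c := hw.trans hwc
  -- The margin `w` turns a lower bound on an infimum into a strict inequality.
  suffices ((t + w : ℝ) : EReal) ≤ firstGap ℓ S from
    (EReal.coe_lt_coe_iff.2 (by linarith)).trans_le this
  refine le_sInf ?_
  rintro _ ⟨m, rfl, hfin, hgap⟩
  by_contra! hlt
  obtain ⟨e, he⟩ : ∃ e : ℝ, epoch S m = e := by
    refine ⟨(epoch S m).toReal, (EReal.coe_toReal hfin.ne ?_).symm⟩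
    exact ((EReal.bot_lt_coe 0).trans_le (epoch_nonneg S m)).ne'
  have he0 : 0 ≤ e := by
    have := epoch_nonneg S m
    rw [he] at this
    exact_mod_cast this
  rw [he, EReal.coe_lt_coe_iff] at hlt
  -- The block containing `e + w`: its end window starts after `e`, and ends by `e + w + c < e + ℓ`.
  set j := ⌊(e + w) / c⌋₊
  have hj1 : j * c ≤ e + w := by
    rw [← le_div_iff₀ hc]
    exact Nat.floor_le (by positivity)
  have hj2 : e + w < (j + 1) * c := by
    rw [← div_lt_iff₀ hc]
    exact Nat.lt_floor_add_one _
  have hjn : j < n := by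
    have : (j : ℝ) * c < n * c := by linarith
    exact_mod_cast lt_of_mul_lt_mul_right this hc.le
  obtain ⟨s, hs, hs1, hs2⟩ := h j hjn
  have hle : epoch S (m + 1) ≤ s :=
    epoch_succ_le hs (by rw [he, EReal.coe_lt_coe_iff]; linarith)
  have : (ℓ : EReal) ≤ ((s - e : ℝ) : EReal) := by
    rw [EReal.coe_sub, ← he]
    exact hgap.trans (EReal.sub_le_sub hle le_rfl)
  rw [EReal.coe_le_coe_iff] at this
  linarith

end Epochs


/-! ### Intensity of intervals under a monotone rate -/

section Intensity

variable {μ : ℝ → ℝ}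

theorem intensityMeasure_Ioc {a b : ℝ} (ha : 0 ≤ a) :
    intensityMeasure μ (Ioc a b) = ∫⁻ t in Ioc a b, ENNReal.ofReal (μ t) := by
  rw [intensityMeasure, withDensity_apply _ measurableSet_Ioc,
    Measure.restrict_restrict measurableSet_Ioc, inter_eq_left.2 fun x (hx : x ∈ Ioc a b) => mem_Ioi.2 (ha.trans_lt hx.1)]

theorem intensityMeasure_Ioc_lt_top (hint : ∀ t : ℝ, IntegrableOn μ (Ioc 0 t) volume) {a b : ℝ}
    (ha : 0 ≤ a) : intensityMeasure μ (Ioc a b) < ⊤ := by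
  rw [intensityMeasure_Ioc ha]
  exact ((hint b).mono_set (Ioc_subset_Ioc_left ha)).lintegral_lt_top

theorem intensityMeasure_Ioc_toReal_pos
    (hpos : ∀ᵐ t ∂(volume.restrict (Ioi (0 : ℝ))), 0 < μ t)
    (hint : ∀ t : ℝ, IntegrableOn μ (Ioc 0 t) volume) {a b : ℝ} (ha : 0 ≤ a) (hab : a < b) :
    0 < (intensityMeasure μ (Ioc a b)).toReal := by
  refine ENNReal.toReal_pos (fun h0 => ?_) (intensityMeasure_Ioc_lt_top hint ha).ne
  rw [intensityMeasure_Ioc ha, lintegral_eq_zero_iff'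
    ((hint b).mono_set (Ioc_subset_Ioc_left ha)).aestronglyMeasurable.aemeasurable.ennreal_ofReal]
    at h0
  have h1 := ae_restrict_of_ae_restrict_of_subset
    (fun x (hx : x ∈ Ioc a b) => mem_Ioi.2 (ha.trans_lt hx.1)) hpos
  have h2 : ∀ᵐ t ∂(volume.restrict (Ioc a b)), False := by
    filter_upwards [h0, h1] with t h3 h4
    exact absurd (ENNReal.ofReal_eq_zero.1 h3) (not_le.2 h4)
  rw [eventually_false_iff_eq_bot, ae_eq_bot, Measure.restrict_eq_zero, Real.volume_Ioc] at h2
  exact absurd (ENNReal.ofReal_eq_zero.1 h2) (by linarith)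

theorem intensityMeasure_Ioc_toReal_le {t₀ a b : ℝ} (hanti : AntitoneOn μ (Ici t₀))
    (ha : 0 ≤ a) (hta : t₀ ≤ a) (hab : a ≤ b) (hμa : 0 ≤ μ a) :
    (intensityMeasure μ (Ioc a b)).toReal ≤ (b - a) * μ a := by
  refine ENNReal.toReal_le_of_le_ofReal (mul_nonneg (by linarith) hμa) ?_
  rw [intensityMeasure_Ioc ha]
  calc ∫⁻ t in Ioc a b, ENNReal.ofReal (μ t) ≤ ∫⁻ t in Ioc a b, ENNReal.ofReal (μ a) := by
        refine setLIntegral_mono' measurableSet_Ioc fun t ht => ENNReal.ofReal_le_ofReal ?_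
        exact hanti hta (hta.trans ht.1.le) ht.1.le
    _ = ENNReal.ofReal ((b - a) * μ a) := by
        rw [setLIntegral_const, Real.volume_Ioc, mul_comm, ENNReal.ofReal_mul (by linarith)]

theorem le_intensityMeasure_Ioc_toReal (hint : ∀ t : ℝ, IntegrableOn μ (Ioc 0 t) volume)
    {t₀ a b : ℝ} (hanti : AntitoneOn μ (Ici t₀)) (ha : 0 ≤ a) (hta : t₀ ≤ a) (hab : a ≤ b) :
    (b - a) * μ b ≤ (intensityMeasure μ (Ioc a b)).toReal := by
  rw [← ENNReal.ofReal_le_iff_le_toReal (intensityMeasure_Ioc_lt_top hint ha).ne,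
    intensityMeasure_Ioc ha]
  calc ENNReal.ofReal ((b - a) * μ b) = ∫⁻ t in Ioc a b, ENNReal.ofReal (μ b) := by
        rw [setLIntegral_const, Real.volume_Ioc, ENNReal.ofReal_mul (sub_nonneg.2 hab),
          mul_comm]
    _ ≤ ∫⁻ t in Ioc a b, ENNReal.ofReal (μ t) := by
        refine setLIntegral_mono' measurableSet_Ioc fun t ht => ENNReal.ofReal_le_ofReal ?_
        exact hanti (hta.trans ht.1.le) (hta.trans hab) ht.2

/-- A rate that is positive almost everywhere and eventually non-increasing is eventually
positive. -/
theorem pos_of_ae_pos_of_antitoneOn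
    (hpos : ∀ᵐ t ∂(volume.restrict (Ioi (0 : ℝ))), 0 < μ t) {t₀ : ℝ}
    (hanti : AntitoneOn μ (Ici t₀)) {t : ℝ} (ht : 0 ≤ t) (htt : t₀ ≤ t) : 0 < μ t := by
  by_contra! hcon
  have h1 := ae_restrict_of_ae_restrict_of_subset
    (fun x (hx : x ∈ Ioi t) => mem_Ioi.2 (ht.trans_lt hx)) hpos
  have h2 : ∀ᵐ s ∂(volume.restrict (Ioi t)), False := by
    filter_upwards [h1, ae_restrict_mem measurableSet_Ioi] with s h3 h4
    exact absurd ((hanti htt (htt.trans (le_of_lt h4)) (le_of_lt h4)).trans hcon) (not_le.2 h3)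
  rw [eventually_false_iff_eq_bot, ae_eq_bot, Measure.restrict_eq_zero, Real.volume_Ioi] at h2
  exact absurd h2 (by simp)

end Intensity

/-! ### Asymptotics of the sums of logarithms -/

section Asymptotics

/-- Partial sums of sequences that are eventually ordered are ordered up to a constant. -/
theorem exists_sum_range_le_add {u v : ℕ → ℝ} (h : ∀ᶠ i in atTop, u i ≤ v i) :
    ∃ C, ∀ n, ∑ i ∈ Finset.range n, u i ≤ C + ∑ i ∈ Finset.range n, v i := by
  obtain ⟨k, hk⟩ := eventually_atTop.1 h
  refine ⟨∑ i ∈ Finset.range k, |u i - v i|, fun n => ?_⟩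
  rw [← sub_le_iff_le_add, ← Finset.sum_sub_distrib]
  calc ∑ i ∈ Finset.range n, (u i - v i)
      ≤ ∑ i ∈ Finset.range n, if i < k then |u i - v i| else 0 := by
        refine Finset.sum_le_sum fun i _ => ?_
        split_ifs with hi
        · exact le_abs_self _
        · linarith [hk i (not_lt.1 hi)]
    _ = ∑ i ∈ (Finset.range n).filter (· < k), |u i - v i| := (Finset.sum_filter _ _).symm
    _ ≤ ∑ i ∈ Finset.range k, |u i - v i| :=
        Finset.sum_le_sum_of_subset_of_nonneg
          (fun i hi => Finset.mem_range.2 (Finset.mem_filter.1 hi).2) fun _ _ _ => abs_nonneg _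

theorem sum_range_succ_eq_sum_Icc (b : ℕ → ℝ) (n : ℕ) :
    ∑ i ∈ Finset.range n, b (i + 1) = ∑ i ∈ Finset.Icc 1 n, b i := by
  rw [Finset.range_eq_Ico, Finset.sum_Ico_add' b 0 n 1]
  rfl

/-- Since `n t ~ t / c`, the term `C + n t * K` is `o(f t)`, while the sum is `~ -c ^ ρ * f (n t) ~
-c ^ (ρ - α) * f t`. -/
theorem tendsto_sum_log_div {μ f : ℝ → ℝ} {α ρ c ℓ : ℝ} (hc : 0 < c) (hℓ : 0 < ℓ)
    (hf : IsRegularlyVarying f α) (hf_lin : Tendsto (fun t : ℝ => t / f t) atTop (𝓝 0))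
    (hsum : SeqEquiv (fun n : ℕ => ∑ i ∈ Finset.Icc 1 n, Real.log (μ ((i : ℝ) * c)))
        (fun n : ℕ => -(c ^ ρ * f (n : ℝ))))
    {n : ℝ → ℕ} (hn : Tendsto (fun t => (n t : ℝ) / t) atTop (𝓝 c⁻¹)) (C K : ℝ) :
    Tendsto (fun t => (C + n t * K + ∑ i ∈ Finset.Icc 1 (n t), Real.log (μ ((i : ℝ) * c)))
      / -(ℓ ^ (ρ - α) * f t)) atTop (𝓝 ((c / ℓ) ^ (ρ - α))) := by
  have hfpos := hf.eventually_pos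
  have hntopR : Tendsto (fun t => (n t : ℝ)) atTop atTop := by
    refine (hn.pos_mul_atTop (inv_pos.2 hc) tendsto_id).congr' ?_
    filter_upwards [eventually_gt_atTop 0] with t ht
    simp only [id]
    field_simp
  have hntop : Tendsto n atTop atTop := tendsto_natCast_atTop_iff.1 hntopR
  have h1 : Tendsto (fun t => 1 / f t) atTop (𝓝 0) := by
    have := hf_lin.mul tendsto_inv_atTop_zero
    rw [mul_zero] at this
    refine this.congr' ?_
    filter_upwards [eventually_gt_atTop 0] with t ht
    field_simp
  have h2 : Tendsto (fun t => (n t : ℝ) / f t) atTop (𝓝 0) := by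
    have := hn.mul hf_lin
    rw [mul_zero] at this
    refine this.congr' ?_
    filter_upwards [eventually_gt_atTop 0] with t ht
    field_simp
  have h3 := hf.tendsto_div (inv_pos.2 hc) hn
  have h4 := hsum.comp hntop
  have h5 := (((h1.const_mul C).add (h2.mul_const K)).div_const (-(ℓ ^ (ρ - α)))).add
    ((h4.mul h3).mul_const (c ^ ρ / ℓ ^ (ρ - α)))
  have hval : (C * 0 + 0 * K) / -(ℓ ^ (ρ - α)) + 1 * c⁻¹ ^ α * (c ^ ρ / ℓ ^ (ρ - α))
      = (c / ℓ) ^ (ρ - α) := by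
    rw [Real.div_rpow hc.le hℓ.le, Real.rpow_sub hc, Real.inv_rpow hc.le]
    ring
  rw [hval] at h5
  refine h5.congr' ?_
  filter_upwards [hfpos, hntopR.eventually hfpos] with t ht hnt
  have hl := Real.rpow_pos_of_pos hℓ (ρ - α)
  have hcr := Real.rpow_pos_of_pos hc ρ
  simp only [Function.comp]
  generalize ∑ i ∈ Finset.Icc 1 (n t), Real.log (μ ((i : ℝ) * c)) = s
  field_simp
  ring

end Asymptotics


theorem pairwise_disjoint_Ioc {x y : ℕ → ℝ} (h : ∀ i j, i < j → y i ≤ x j) :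
    Pairwise (fun i j => Disjoint (Ioc (x i) (y i)) (Ioc (x j) (y j))) :=
  (pairwise_disjoint_on fun i => Ioc (x i) (y i)).2 fun i j hij =>
    Set.disjoint_left.2 fun _ hi hj => not_lt.2 (hi.2.trans (h i j hij)) hj.1

theorem succ_mul_le_of_lt {c : ℝ} (hc : 0 ≤ c) {i j : ℕ} (h : i < j) :
    ((i : ℝ) + 1) * c + c ≤ (j + 1) * c := by
  have h1 : (i : ℝ) + 1 ≤ j := by exact_mod_cast h
  nlinarith

theorem one_sub_exp_neg_pos {x : ℝ} (hx : 0 < x) : 0 < 1 - Real.exp (-x) := by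
  simpa using hx

/-- From `1 + y ≤ exp y`. For bounded `y` the logarithm of the right side is at least `log y - B`.
-/
theorem mul_exp_neg_le_one_sub_exp_neg {x y B : ℝ} (hy : 0 ≤ y) (hyx : y ≤ x) (hyB : y ≤ B) :
    y * Real.exp (-B) ≤ 1 - Real.exp (-x) := by
  have h1 : Real.exp (-x) ≤ Real.exp (-y) := Real.exp_le_exp.2 (by linarith)
  have h2 : y * Real.exp (-B) ≤ y * Real.exp (-y) :=
    mul_le_mul_of_nonneg_left (Real.exp_le_exp.2 (by linarith)) hy
  have h3 : (y + 1) * Real.exp (-y) ≤ 1 := by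
    calc (y + 1) * Real.exp (-y) ≤ Real.exp y * Real.exp (-y) :=
          mul_le_mul_of_nonneg_right (Real.add_one_le_exp y) (Real.exp_pos _).le
      _ = 1 := by rw [← Real.exp_add, add_neg_cancel, Real.exp_zero]
  linarith

/-! ### Two-sided bounds for the tail of `D` -/

section Bounds

variable {Ω : Type*} [MeasurableSpace Ω] {P : Measure Ω} [IsProbabilityMeasure P]
  {μ : ℝ → ℝ} {N : Ω → Set ℝ} {ℓ : ℝ}

theorem exists_log_firstGap_le
    (hμ_pos : ∀ᵐ t ∂(volume.restrict (Ioi (0 : ℝ))), 0 < μ t)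
    (hμ_int : ∀ t : ℝ, IntegrableOn μ (Ioc 0 t) volume)
    (hN : IsPoissonProcess N (intensityMeasure μ) P) (hℓ : 0 < ℓ)
    {t₀ : ℝ} (hanti : AntitoneOn μ (Ici t₀)) :
    ∃ C, ∀ t : ℝ, 0 ≤ t → 0 < P.real {ω | (t : EReal) < firstGap ℓ (N ω)} →
      Real.log (P.real {ω | (t : EReal) < firstGap ℓ (N ω)})
        ≤ C + ⌊ℓ⁻¹ * t⌋₊ * Real.log ℓ
          + ∑ i ∈ Finset.Icc 1 ⌊ℓ⁻¹ * t⌋₊, Real.log (μ ((i : ℝ) * ℓ)) := by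
  -- Blocks start at `ℓ`, not `0`, so that their left endpoints, where `μ` is eventually largest,
  -- are the points `i * ℓ` with `i ≥ 1`.
  set a : ℕ → ℝ := fun i => ((i : ℝ) + 1) * ℓ
  have ha0 : ∀ i, 0 ≤ a i := fun i => by positivity
  set m : ℕ → ℝ := fun i => (intensityMeasure μ (Ioc (a i) (a i + ℓ))).toReal
  have hmpos : ∀ i, 0 < m i := fun i =>
    intensityMeasure_Ioc_toReal_pos hμ_pos hμ_int (ha0 i) (by linarith)
  have hev : ∀ᶠ i : ℕ in atTop, Real.log (1 - Real.exp (-m i))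
      ≤ Real.log ℓ + Real.log (μ (((i + 1 : ℕ) : ℝ) * ℓ)) := by
    have hat : Tendsto a atTop atTop :=
      (tendsto_atTop_add_const_right _ 1 tendsto_natCast_atTop_atTop).atTop_mul_const hℓ
    filter_upwards [hat.eventually_ge_atTop t₀] with i hi
    have hμi := pos_of_ae_pos_of_antitoneOn hμ_pos hanti (ha0 i) hi
    have h1 := intensityMeasure_Ioc_toReal_le hanti (ha0 i) hi
      (by linarith : a i ≤ a i + ℓ) hμi.le
    rw [add_sub_cancel_left] at h1
    push_cast
    rw [← Real.log_mul hℓ.ne' hμi.ne']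
    refine Real.log_le_log (one_sub_exp_neg_pos (hmpos i)) (le_trans ?_ h1)
    linarith [Real.add_one_le_exp (-m i)]
  obtain ⟨C, hC⟩ := exists_sum_range_le_add hev
  refine ⟨C, fun t ht hp => ?_⟩
  set n := ⌊ℓ⁻¹ * t⌋₊
  have hnt : n * ℓ ≤ t := by
    rw [← le_div_iff₀ hℓ, div_eq_inv_mul]
    exact Nat.floor_le (by positivity)
  have hsub : P.real {ω | (t : EReal) < firstGap ℓ (N ω)}
      ≤ P.real {ω | ∀ i < n, (N ω ∩ Ioc (a i) (a i + ℓ)).Nonempty} := by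
    refine ENNReal.toReal_mono (measure_ne_top _ _) (measure_mono_ae ?_)
    filter_upwards [hN.ae_finite_inter measurableSet_Ioc
      (intensityMeasure_Ioc_lt_top hμ_int le_rfl (b := t + 1))] with ω hω hgap i hi
    have hai : a i ≤ t := by
      refine le_trans ?_ hnt
      exact mul_le_mul_of_nonneg_right (by exact_mod_cast hi) hℓ.le
    exact inter_nonempty_of_lt_firstGap (hN.subset_Ioi ω)
      (hω.subset (inter_subset_inter_right _ (Ioc_subset_Ioc_right (by linarith))))
      (ha0 i) hai hgap
  rw [hN.measureReal_forall_inter_nonempty (fun _ => measurableSet_Ioc)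
    (pairwise_disjoint_Ioc fun i j hij => succ_mul_le_of_lt hℓ.le hij)
    (fun i => intensityMeasure_Ioc_lt_top hμ_int (ha0 i))] at hsub
  refine (Real.log_le_log hp hsub).trans ?_
  rw [Real.log_prod fun i _ => (one_sub_exp_neg_pos (hmpos i)).ne']
  refine (hC n).trans (le_of_eq ?_)
  rw [Finset.sum_add_distrib, Finset.sum_const, Finset.card_range, nsmul_eq_mul,
    sum_range_succ_eq_sum_Icc fun i : ℕ => Real.log (μ ((i : ℝ) * ℓ)), add_assoc]

theorem exists_le_log_firstGap
    (hμ_pos : ∀ᵐ t ∂(volume.restrict (Ioi (0 : ℝ))), 0 < μ t)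
    (hμ_int : ∀ t : ℝ, IntegrableOn μ (Ioc 0 t) volume)
    (hN : IsPoissonProcess N (intensityMeasure μ) P)
    {t₀ : ℝ} (hanti : AntitoneOn μ (Ici t₀)) {c : ℝ} (hc : 0 < c) (hcℓ : c < ℓ) :
    ∃ C K, ∀ t : ℝ, 0 < P.real {ω | (t : EReal) < firstGap ℓ (N ω)} ∧
      C + ((⌈c⁻¹ * t⌉₊ + 2 : ℕ) : ℝ) * K
          + ∑ i ∈ Finset.Icc 1 (⌈c⁻¹ * t⌉₊ + 2), Real.log (μ ((i : ℝ) * c))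
        ≤ Real.log (P.real {ω | (t : EReal) < firstGap ℓ (N ω)}) := by
  -- Any `w` below `c` and `ℓ - c`: points in consecutive windows are then less than `c + w < ℓ`
  -- apart.
  obtain ⟨w, hw0, hwmin⟩ := exists_between (lt_min hc (sub_pos.2 hcℓ))
  have hwc : w < c := hwmin.trans_le (min_le_left _ _)
  have hcw : c + w < ℓ := by linarith [hwmin.trans_le (min_le_right c (ℓ - c))]
  set b : ℕ → ℝ := fun i => ((i : ℝ) + 1) * c with hb
  have hcb : ∀ i, c ≤ b i := fun i => by
    have : (0 : ℝ) ≤ i * c := by positivity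
    simp only [hb]
    linarith
  have ha0 : ∀ i, 0 ≤ b i - w := fun i => by linarith [hcb i]
  set m : ℕ → ℝ := fun i => (intensityMeasure μ (Ioc (b i - w) (b i))).toReal
  have hmpos : ∀ i, 0 < m i := fun i =>
    intensityMeasure_Ioc_toReal_pos hμ_pos hμ_int (ha0 i) (by linarith)
  set t₁ := max t₀ 0
  -- Eventual bound for `w * μ (b i)`, by monotonicity beyond `t₁`.
  set B := w * μ t₁
  set K := Real.log w - B
  have hev : ∀ᶠ i : ℕ in atTop, K + Real.log (μ (((i + 1 : ℕ) : ℝ) * c))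
      ≤ Real.log (1 - Real.exp (-m i)) := by
    have hbt : Tendsto b atTop atTop :=
      (tendsto_atTop_add_const_right _ 1 tendsto_natCast_atTop_atTop).atTop_mul_const hc
    filter_upwards [hbt.eventually_ge_atTop (t₁ + w)] with i hi
    have ht1 : t₀ ≤ t₁ := le_max_left _ _
    have hμi := pos_of_ae_pos_of_antitoneOn hμ_pos hanti (hc.le.trans (hcb i))
      (by linarith : t₀ ≤ b i)
    have h1 := le_intensityMeasure_Ioc_toReal hμ_int hanti (ha0 i)
      (by linarith : t₀ ≤ b i - w) (by linarith : b i - w ≤ b i)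
    rw [sub_sub_cancel] at h1
    have h2 : w * μ (b i) ≤ B := mul_le_mul_of_nonneg_left
      (hanti ht1 (by simp only [mem_Ici]; linarith) (by linarith)) hw0.le
    have h3 := mul_exp_neg_le_one_sub_exp_neg (by positivity) h1 h2
    push_cast
    have h4 := Real.log_le_log (by positivity) h3
    rw [Real.log_mul (by positivity) (Real.exp_pos _).ne', Real.log_exp,
      Real.log_mul hw0.ne' hμi.ne'] at h4
    linarith
  obtain ⟨C, hC⟩ := exists_sum_range_le_add hev
  refine ⟨-C, K, fun t => ?_⟩
  set n := ⌈c⁻¹ * t⌉₊ + 2 with hn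
  have hnt : t + 2 * c ≤ n * c := by
    have : t ≤ ⌈c⁻¹ * t⌉₊ * c := by
      rw [← div_le_iff₀ hc, div_eq_inv_mul]
      exact Nat.le_ceil _
    rw [hn]
    push_cast
    linarith
  have hsub : P.real {ω | ∀ i < n, (N ω ∩ Ioc (b i - w) (b i)).Nonempty}
      ≤ P.real {ω | (t : EReal) < firstGap ℓ (N ω)} :=
    measureReal_mono fun ω hω => lt_firstGap_of_forall_inter_nonempty hw0 hwc hcw hnt hω
  have hprod : 0 < ∏ i ∈ Finset.range n, (1 - Real.exp (-m i)) :=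
    Finset.prod_pos fun i _ => one_sub_exp_neg_pos (hmpos i)
  rw [hN.measureReal_forall_inter_nonempty (fun _ => measurableSet_Ioc)
    (pairwise_disjoint_Ioc fun i j hij => by
      have := succ_mul_le_of_lt hc.le hij
      simp only [hb]
      linarith)
    (fun i => intensityMeasure_Ioc_lt_top hμ_int (ha0 i))] at hsub
  refine ⟨hprod.trans_le hsub, le_trans ?_ (Real.log_le_log hprod hsub)⟩
  rw [Real.log_prod fun i _ => (one_sub_exp_neg_pos (hmpos i)).ne']
  have h5 := hC n
  rw [Finset.sum_add_distrib, Finset.sum_const, Finset.card_range, nsmul_eq_mul,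
    sum_range_succ_eq_sum_Icc fun i : ℕ => Real.log (μ ((i : ℝ) * c))] at h5
  linarith

end Bounds

end FirstGap

/-! ### The squeeze -/

theorem mainTheorem3 {Ω : Type*} [MeasurableSpace Ω] (P : Measure Ω) [IsProbabilityMeasure P]
    (μ : ℝ → ℝ) (hμ_nonneg : ∀ t : ℝ, 0 < t → 0 ≤ μ t)
    (hμ_pos : ∀ᵐ t ∂(volume.restrict (Ioi (0 : ℝ))), 0 < μ t)
    (hμ_int : ∀ t : ℝ, IntegrableOn μ (Ioc 0 t) volume)
    (N : Ω → Set ℝ) (hN : FirstGap.IsPoissonProcess N (FirstGap.intensityMeasure μ) P)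
    (ℓ : ℝ) (hℓ : 0 < ℓ)
    (hμ_anti : ∃ t₀ : ℝ, AntitoneOn μ (Ici t₀))
    (f : ℝ → ℝ) (α : ℝ) (hα : 1 ≤ α) (hf : FirstGap.IsRegularlyVarying f α)
    (hf_lin : Tendsto (fun t : ℝ => t / f t) atTop (𝓝 0))
    (ρ : ℝ)
    (hsum : ∀ c : ℝ, 0 < c →
      FirstGap.SeqEquiv (fun n : ℕ => ∑ i ∈ Finset.Icc 1 n, Real.log (μ ((i : ℝ) * c)))
        (fun n : ℕ => -(c ^ ρ * f (n : ℝ)))) :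
    FirstGap.LogEquiv
      (fun t : ℝ => P.real {ω : Ω | (t : EReal) < FirstGap.firstGap ℓ (N ω)})
      (fun t : ℝ => Real.exp (-(ℓ ^ (ρ - α) * f t))) := by 
  obtain ⟨t₀, hanti⟩ := hμ_anti
  obtain ⟨C, hC⟩ := FirstGap.exists_log_firstGap_le hμ_pos hμ_int hN hℓ hanti
  have hfpos := hf.eventually_pos
  have hl := Real.rpow_pos_of_pos hℓ (ρ - α)
  have lower {c : ℝ} (hc : 0 < c) (hcℓ : c < ℓ) :=
    FirstGap.exists_le_log_firstGap hμ_pos hμ_int hN hanti hc hcℓ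
  have hp (t : ℝ) : 0 < P.real {ω : Ω | (t : EReal) < FirstGap.firstGap ℓ (N ω)} := by
    obtain ⟨_, _, h⟩ := lower (half_pos hℓ) (half_lt_self hℓ)
    exact (h t).1
  rw [FirstGap.LogEquiv]
  simp only [Real.log_exp]
  refine tendsto_order.2 ⟨fun a ha => ?_, fun a ha => ?_⟩
  · have h1 := FirstGap.tendsto_sum_log_div hℓ hℓ hf hf_lin (hsum ℓ hℓ)
      (tendsto_nat_floor_mul_div_atTop (inv_nonneg.2 hℓ.le)) C (Real.log ℓ)
    rw [div_self hℓ.ne', Real.one_rpow] at h1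
    filter_upwards [h1.eventually (lt_mem_nhds ha), hfpos, eventually_ge_atTop 0] with t h2 hft ht
    -- The denominator is negative, so the upper bound on the logarithm bounds the ratio from below.
    refine h2.trans_le (div_le_div_of_nonpos_of_le ?_ (hC t ht (hp t)))
    exact neg_nonpos.2 (by positivity)
  · have hcont : Tendsto (fun c : ℝ => (c / ℓ) ^ (ρ - α)) (𝓝[<] ℓ) (𝓝 1) := by
      have h : ContinuousAt (fun c : ℝ => (c / ℓ) ^ (ρ - α)) ℓ :=
        (continuousAt_id.div_const ℓ).rpow_const (Or.inl (by simp [hℓ.ne']))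
      have h' := h.tendsto
      rw [div_self hℓ.ne', Real.one_rpow] at h'
      exact h'.mono_left nhdsWithin_le_nhds
    -- `c < ℓ` is fixed so close to `ℓ` that the limit ratio `(c / ℓ) ^ (ρ - α)` is already below
    -- `a`.
    obtain ⟨c, hca, hc, hcℓ⟩ :=
      ((hcont.eventually (gt_mem_nhds ha)).and (Ioo_mem_nhdsLT hℓ)).exists
    obtain ⟨C', K, hCK⟩ := lower hc hcℓ
    have hn : Tendsto (fun t : ℝ => ((⌈c⁻¹ * t⌉₊ + 2 : ℕ) : ℝ) / t) atTop (𝓝 c⁻¹) := by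
      have h := (tendsto_nat_ceil_mul_div_atTop (inv_nonneg.2 hc.le)).add
        (tendsto_inv_atTop_zero.const_mul (2 : ℝ))
      rw [mul_zero, add_zero] at h
      refine h.congr fun t => ?_
      push_cast
      ring
    have h1 := FirstGap.tendsto_sum_log_div hc hℓ hf hf_lin (hsum c hc) hn C' K
    filter_upwards [h1.eventually (gt_mem_nhds hca), hfpos] with t h2 hft
    refine lt_of_le_of_lt (div_le_div_of_nonpos_of_le ?_ (hCK t).2) h2
    exact neg_nonpos.2 (by positivity)
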